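/- Let $\mu$ be a finite positive Borel measure on the unit circle $\partial\mathbb{D}$ with infinite support, and let $\{\Phi_n\}_{n\ge 0}$ be its monic orthogonal polynomials, i.e. $\Phi_n$ is monic of degree $n$ and $\int_{\partial\mathbb{D}}\Phi_n\overline{\Phi_m}\,d\mu=k_n^{-2}\delta_{nm}$ with $k_n^{-2}\neq 0$. Let $(a_n)_{n\ge 1}$ be complex numbers, not all zero, and put $\tilde\Phi_0=\Phi_0$ and $$\tilde\Phi_n(z)=\Phi_n(z)-a_n\Phi_{n-1}(z),\qquad n\ge 1 .$$ Suppose that $\tilde\mu$ is a finite positive Borel measure on $\partial\mathbb{D}$ such that $\{\tilde\Phi_n\}_{n\ge 0}$ is a sequence of monic orthogonal polynomials with respect to $\tilde\mu$ (in the same sense). Then $\tilde\mu$ is absolutely continuous with respect to Lebesgue (arc length) measure $d\theta$ on $\partial\mathbb{D}$, and its density $\tilde\mu'(\theta)$ with respect to $d\theta$ lies in $L^2(0,2\pi)$. -/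

import Mathlib

open MeasureTheory Polynomial
open scoped ComplexConjugate

/-- The unit circle carries its Borel σ-algebra. -/
noncomputable instance instMeasurableSpaceCircle : MeasurableSpace Circle := borel Circle

instance instBorelSpaceCircle : BorelSpace Circle := ⟨rfl⟩

/-- `Φ` is a sequence of monic orthogonal polynomials on the unit circle with respect to the
positive measure `μ`: `Φ n` is monic of degree `n`, and `∫ Φ_n conj(Φ_m) dμ = k_n⁻² δ_{nm}`
with `k_n⁻² ≠ 0`. -/
structure IsMonicOPUC (μ : Measure Circle) (Φ : ℕ → ℂ[X]) : Prop where
  monic : ∀ n, (Φ n).Monic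
  natDegree_eq : ∀ n, (Φ n).natDegree = n
  orthogonal : ∀ n m, n ≠ m →
    ∫ z : Circle, (Φ n).eval (z : ℂ) * conj ((Φ m).eval (z : ℂ)) ∂μ = 0
  norm_ne_zero : ∀ n,
    ∫ z : Circle, (Φ n).eval (z : ℂ) * conj ((Φ n).eval (z : ℂ)) ∂μ ≠ 0

/-- The quasi-orthogonal polynomials of order one `Φ_n - a_n Φ_{n-1}`, with the convention
`Φ_{-1} = 0` (so the value `a 0` plays no role). -/
noncomputable def quasiOPUC (Φ : ℕ → ℂ[X]) (a : ℕ → ℂ) : ℕ → ℂ[X]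
  | 0 => Φ 0
  | n + 1 => Φ (n + 1) - C (a (n + 1)) * Φ n

/-- Lebesgue (arc length) measure on the unit circle, of total mass `2π`: the image of Lebesgue
measure on `(0, 2π)` under `θ ↦ exp (iθ)`. -/
noncomputable def circleLebesgue : Measure Circle :=
  (volume.restrict (Set.Ioo (0 : ℝ) (2 * Real.pi))).map Circle.exp

/-- The density `μ'(θ)` on `(0, 2π)` of (the absolutely continuous part of) a measure on the unit
circle with respect to `dθ`. -/
noncomputable def circleDensity (μ : Measure Circle) (θ : ℝ) : ℝ :=
  (μ.rnDeriv circleLebesgue (Circle.exp θ)).toReal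

/-! Write Φ*_n for the Szegő reversal, Φt_n for `quasiOPUC Φ a n`, and d_n = Φ_n(0). Both families
satisfy a Szegő recurrence; subtracting one from the other leaves a linear relation between Φ_m and
Φ*_m (`quasiOPUC_recurrence`). For m ≥ 1 these are independent, since |d_m| ≠ 1, so both
coefficients vanish. One gives a_m = 0 ↔ a_{m+1} = 0 for m ≥ 2, the other Φt_{m+2}(0) * conj a_{m+1}
= 0. Since some a_n is nonzero, the case m = 0 excludes a_2 = 0, and hence Φt_{m+2} = z^m P with P =
Φt_2 (`quasiOPUC_add_two`).

Orthogonality of z^k P to P then says that |P|² dμt has no moments of order k ≥ 1, so it is c dθ. As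
P has no zero on the circle, dμt = c |P|⁻² dθ has a bounded density. -/

/-- The sesquilinear form `⟨p, q⟩ = ∫ p conj(q) dμ` on polynomials. -/
noncomputable def circleForm (μ : Measure Circle) (p q : ℂ[X]) : ℂ :=
  ∫ z : Circle, p.eval (z : ℂ) * conj (q.eval (z : ℂ)) ∂μ

/-- The Szegő reversal `z ^ n * conj (p (1 / conj z))` of a polynomial of degree at most `n`. -/
noncomputable def szegoReverse (n : ℕ) (p : ℂ[X]) : ℂ[X] :=
  (p.map (starRingEnd ℂ)).reflect n

lemma continuous_eval_circle (p : ℂ[X]) : Continuous fun z : Circle => p.eval (z : ℂ) :=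
  p.continuous.comp (by fun_prop)

lemma integrable_of_continuous_circle {μ : Measure Circle} [IsFiniteMeasure μ] {f : Circle → ℂ}
    (hf : Continuous f) : Integrable f μ := by
  rw [← integrableOn_univ]
  exact hf.continuousOn.integrableOn_compact isCompact_univ

lemma Circle.mul_conj_coe (z : Circle) : (z : ℂ) * conj (z : ℂ) = 1 := by
  rw [Complex.mul_conj, Circle.normSq_coe, Complex.ofReal_one]

/-! ### Szegő reversal of polynomials -/

section Reverse

lemma szegoReverse_add (n : ℕ) (p q : ℂ[X]) :
    szegoReverse n (p + q) = szegoReverse n p + szegoReverse n q := by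
  simp [szegoReverse, reflect_add]

lemma szegoReverse_sub (n : ℕ) (p q : ℂ[X]) :
    szegoReverse n (p - q) = szegoReverse n p - szegoReverse n q := by
  simp [szegoReverse, reflect_sub]

lemma szegoReverse_C_mul (n : ℕ) (c : ℂ) (p : ℂ[X]) :
    szegoReverse n (C c * p) = C (conj c) * szegoReverse n p := by
  simp [szegoReverse, reflect_C_mul]

lemma szegoReverse_szegoReverse (n : ℕ) (p : ℂ[X]) :
    szegoReverse n (szegoReverse n p) = p := by
  ext i
  simp [szegoReverse, ← reflect_map]

lemma szegoReverse_succ {n : ℕ} {p : ℂ[X]} (hp : p.natDegree ≤ n) :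
    szegoReverse (n + 1) p = X * szegoReverse n p := by
  have h := reflect_mul (p.map (starRingEnd ℂ)) 1 (F := n) (G := 1)
    (natDegree_map_le.trans hp) (by simp)
  rw [mul_one, reflect_one, pow_one] at h
  rw [szegoReverse, h, mul_comm]; rfl

lemma szegoReverse_succ_X_mul {n : ℕ} {p : ℂ[X]} (hp : p.natDegree ≤ n) :
    szegoReverse (n + 1) (X * p) = szegoReverse n p := by
  have h := reflect_mul (p.map (starRingEnd ℂ)) X (F := n) (G := 1)
    (natDegree_map_le.trans hp) (by simp)
  rw [reflect_one_X, mul_one] at h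
  rw [szegoReverse, Polynomial.map_mul, map_X, mul_comm, h]; rfl

lemma natDegree_szegoReverse_le {n : ℕ} {p : ℂ[X]} (hp : p.natDegree ≤ n) :
    (szegoReverse n p).natDegree ≤ n :=
  natDegree_reflect_le.trans (max_le le_rfl (natDegree_map_le.trans hp))

lemma coeff_szegoReverse {n i : ℕ} (hi : i ≤ n) (p : ℂ[X]) :
    (szegoReverse n p).coeff i = conj (p.coeff (n - i)) := by
  simp [szegoReverse, coeff_reflect, revAt_le hi]

lemma eval_szegoReverse {n : ℕ} {p : ℂ[X]} (hp : p.natDegree ≤ n) (z : Circle) :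
    (szegoReverse n p).eval (z : ℂ) = (z : ℂ) ^ n * conj (p.eval (z : ℂ)) := by
  rw [eval_eq_sum_range' (Nat.lt_succ_of_le (natDegree_szegoReverse_le hp)),
    eval_eq_sum_range' (Nat.lt_succ_of_le hp), map_sum, Finset.mul_sum,
    ← Finset.sum_range_reflect]
  refine Finset.sum_congr rfl fun i hi => ?_
  have hi : i ≤ n := Nat.lt_succ_iff.mp (Finset.mem_range.mp hi)
  rw [show n + 1 - 1 - i = n - i by omega, coeff_szegoReverse (Nat.sub_le _ _),
    Nat.sub_sub_self hi, map_mul, map_pow]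
  have h : (z : ℂ) ^ n = (z : ℂ) ^ (n - i) * (z : ℂ) ^ i := by
    rw [← pow_add, Nat.sub_add_cancel hi]
  have h1 : (z : ℂ) ^ i * conj (z : ℂ) ^ i = 1 := by
    rw [← mul_pow, Circle.mul_conj_coe, one_pow]
  rw [h]
  linear_combination (-(conj (p.coeff i)) * (z : ℂ) ^ (n - i)) * h1

end Reverse

/-! ### The sesquilinear form of a measure -/

section Form

variable {μ : Measure Circle}

lemma circleForm_conj (p q : ℂ[X]) : conj (circleForm μ p q) = circleForm μ q p := by
  rw [circleForm, ← integral_conj]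
  simp [circleForm, mul_comm]

lemma circleForm_C_mul_left (c : ℂ) (p q : ℂ[X]) :
    circleForm μ (C c * p) q = c * circleForm μ p q := by
  simp [circleForm, mul_assoc, integral_const_mul]

lemma circleForm_C_mul_right (c : ℂ) (p q : ℂ[X]) :
    circleForm μ p (C c * q) = conj c * circleForm μ p q := by
  rw [← circleForm_conj, circleForm_C_mul_left, map_mul, circleForm_conj]

lemma circleForm_X_mul (p q : ℂ[X]) : circleForm μ (X * p) (X * q) = circleForm μ p q := by
  refine integral_congr_ae (.of_forall fun z => ?_)
  simp only [eval_mul, eval_X, map_mul]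
  linear_combination (p.eval (z : ℂ) * conj (q.eval (z : ℂ))) * Circle.mul_conj_coe z

lemma circleForm_szegoReverse {n : ℕ} {p q : ℂ[X]} (hp : p.natDegree ≤ n)
    (hq : q.natDegree ≤ n) :
    circleForm μ (szegoReverse n p) (szegoReverse n q) = circleForm μ q p := by
  refine integral_congr_ae (.of_forall fun z => ?_)
  simp only [eval_szegoReverse hp, eval_szegoReverse hq, map_mul, map_pow, Complex.conj_conj]
  have h1 : (z : ℂ) ^ n * conj (z : ℂ) ^ n = 1 := by
    rw [← mul_pow, Circle.mul_conj_coe, one_pow]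
  linear_combination (q.eval (z : ℂ) * conj (p.eval (z : ℂ))) * h1

variable [IsFiniteMeasure μ]

lemma circleForm_add_left (p q r : ℂ[X]) :
    circleForm μ (p + q) r = circleForm μ p r + circleForm μ q r := by
  have h (p r : ℂ[X]) : Integrable
      (fun z : Circle => p.eval (z : ℂ) * conj (r.eval (z : ℂ))) μ :=
    integrable_of_continuous_circle ((continuous_eval_circle p).mul
      (Complex.continuous_conj.comp (continuous_eval_circle r)))
  simp only [circleForm, eval_add, add_mul]
  exact integral_add (h p r) (h q r)

lemma circleForm_add_right (p q r : ℂ[X]) :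
    circleForm μ p (q + r) = circleForm μ p q + circleForm μ p r := by
  rw [← circleForm_conj, circleForm_add_left, map_add, circleForm_conj, circleForm_conj]

lemma circleForm_sub_left (p q r : ℂ[X]) :
    circleForm μ (p - q) r = circleForm μ p r - circleForm μ q r := by
  rw [eq_sub_iff_add_eq, ← circleForm_add_left, sub_add_cancel]

lemma circleForm_sub_right (p q r : ℂ[X]) :
    circleForm μ p (q - r) = circleForm μ p q - circleForm μ p r := by
  rw [eq_sub_iff_add_eq, ← circleForm_add_right, sub_add_cancel]

lemma circleForm_eq_zero_of_X_pow {p q : ℂ[X]} {n : ℕ} (hq : q.degree < n)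
    (h : ∀ j < n, circleForm μ p (X ^ j) = 0) : circleForm μ p q = 0 := by
  classical
  have hq' := mem_degreeLT.mpr hq
  rw [degreeLT_eq_span_X_pow] at hq'
  clear hq
  induction hq' using Submodule.span_induction with
  | mem x hx =>
    simp only [Finset.coe_image, Finset.coe_range, Set.mem_image, Set.mem_Iio] at hx
    obtain ⟨j, hj, rfl⟩ := hx
    exact h j hj
  | zero => simp [circleForm]
  | add x y _ _ hx hy =>
    exact (circleForm_add_right p x y).trans (by rw [hx, hy, add_zero])
  | smul c x _ hx => rw [smul_eq_C_mul, circleForm_C_mul_right, hx, mul_zero]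

end Form

/-! ### Szegő recurrence and zeros -/

namespace IsMonicOPUC

variable {μ : Measure Circle} {Φ : ℕ → ℂ[X]}

lemma coeff_self (hΦ : IsMonicOPUC μ Φ) (n : ℕ) : (Φ n).coeff n = 1 := by
  have h := hΦ.monic n
  rwa [Monic, leadingCoeff, hΦ.natDegree_eq] at h

lemma circleForm_self_ne_zero (hΦ : IsMonicOPUC μ Φ) (n : ℕ) :
    circleForm μ (Φ n) (Φ n) ≠ 0 := hΦ.norm_ne_zero n

lemma degree_sub_lt (hΦ : IsMonicOPUC μ Φ) {n : ℕ} {q : ℂ[X]} (hq : q.degree < (n + 1 : ℕ)) :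
    (q - C (q.coeff n) * Φ n).degree < n := by
  rw [degree_lt_iff_coeff_zero] at hq ⊢
  intro m hm
  rcases hm.eq_or_lt with rfl | hm
  · simp [hΦ.coeff_self]
  · have : (Φ n).coeff m = 0 := coeff_eq_zero_of_natDegree_lt (by rwa [hΦ.natDegree_eq])
    simp [hq m hm, this]

variable [IsFiniteMeasure μ]

lemma circleForm_eq_zero_of_degree_lt (hΦ : IsMonicOPUC μ Φ) {n : ℕ} {q : ℂ[X]}
    (hq : q.degree < n) : circleForm μ (Φ n) q = 0 := by
  suffices H : ∀ k ≤ n, ∀ q : ℂ[X], q.degree < k → circleForm μ (Φ n) q = 0 from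
    H n le_rfl q hq
  intro k
  induction k with
  | zero =>
    intro _ q hq
    have : q = 0 := by simpa using hq
    simp [this, circleForm]
  | succ k ih =>
    intro hk q hq
    have h := ih (by omega) _ (hΦ.degree_sub_lt hq)
    rw [circleForm_sub_right, circleForm_C_mul_right] at h
    have h0 : circleForm μ (Φ n) (Φ k) = 0 := hΦ.orthogonal n k (by omega)
    simpa [h0] using h

lemma eq_zero_of_forall_X_pow (hΦ : IsMonicOPUC μ Φ) {n : ℕ} {p : ℂ[X]} (hp : p.degree < n)
    (h : ∀ j < n, circleForm μ p (X ^ j) = 0) : p = 0 := by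
  induction n with
  | zero => simpa using hp
  | succ n ih =>
    have h1 : circleForm μ p (Φ n) = 0 := by
      refine circleForm_eq_zero_of_X_pow (n := n + 1) ?_ h
      rw [degree_eq_natDegree (hΦ.monic n).ne_zero, hΦ.natDegree_eq]
      exact_mod_cast n.lt_succ_self
    have h2 := hΦ.circleForm_eq_zero_of_degree_lt (hΦ.degree_sub_lt hp)
    rw [circleForm_sub_right, ← circleForm_conj, h1, circleForm_C_mul_right, map_zero, zero_sub,
      neg_eq_zero, mul_eq_zero, or_iff_left (hΦ.circleForm_self_ne_zero n),
      map_eq_zero] at h2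
    refine ih ?_ fun j hj => h j (by omega)
    have h3 := hΦ.degree_sub_lt hp
    rwa [h2, C_0, zero_mul, sub_zero] at h3

lemma circleForm_X_pow (hΦ : IsMonicOPUC μ Φ) {n j : ℕ} (hj : j < n) :
    circleForm μ (Φ n) (X ^ j) = 0 :=
  hΦ.circleForm_eq_zero_of_degree_lt (by rw [degree_X_pow]; exact_mod_cast hj)

/-- Reversal is anti-unitary and sends X^i to X^(n-i), so it carries orthogonality to 1, ...,
X^(n-1) to orthogonality to X, ..., X^n. -/
lemma circleForm_szegoReverse_X_pow (hΦ : IsMonicOPUC μ Φ) {n j : ℕ} (hj : j < n) :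
    circleForm μ (szegoReverse n (Φ n)) (X ^ (j + 1)) = 0 := by
  have h : szegoReverse n (X ^ (n - (j + 1)) : ℂ[X]) = X ^ (j + 1) := by
    rw [szegoReverse, Polynomial.map_pow, map_X, reflect_monomial, revAt_le (Nat.sub_le _ _),
      Nat.sub_sub_self hj]
  rw [← h, circleForm_szegoReverse (hΦ.natDegree_eq n).le (by simp), ← circleForm_conj,
    hΦ.circleForm_X_pow (by omega), map_zero]

omit [IsFiniteMeasure μ] in
lemma coeff_zero_szegoReverse (hΦ : IsMonicOPUC μ Φ) (n : ℕ) :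
    (szegoReverse n (Φ n)).coeff 0 = 1 := by
  rw [coeff_szegoReverse n.zero_le, Nat.sub_zero, hΦ.coeff_self, map_one]

/-- The Szegő recurrence. -/
lemma szego_recurrence (hΦ : IsMonicOPUC μ Φ) (n : ℕ) :
    Φ (n + 1) = X * Φ n + C ((Φ (n + 1)).coeff 0) * szegoReverse n (Φ n) := by
  set r := Φ (n + 1) - X * Φ n - C ((Φ (n + 1)).coeff 0) * szegoReverse n (Φ n) with hr
  have hdeg : r.degree < (n + 1 : ℕ) := by
    rw [degree_lt_iff_coeff_zero]
    intro m hm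
    obtain ⟨m, rfl⟩ : ∃ k, m = k + 1 := ⟨m - 1, by omega⟩
    have h1 : (szegoReverse n (Φ n)).coeff (m + 1) = 0 :=
      coeff_eq_zero_of_natDegree_lt
        ((natDegree_szegoReverse_le (hΦ.natDegree_eq n).le).trans_lt (by omega))
    have h2 : (Φ (n + 1)).coeff (m + 1) = (Φ n).coeff m := by
      rcases (show n ≤ m by omega).eq_or_lt with rfl | hlt
      · rw [hΦ.coeff_self, hΦ.coeff_self]
      · rw [coeff_eq_zero_of_natDegree_lt (by rw [hΦ.natDegree_eq]; omega),
          coeff_eq_zero_of_natDegree_lt (by rw [hΦ.natDegree_eq]; omega)]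
    simp [hr, h1, h2]
  have h0 : r.coeff 0 = 0 := by
    simp [hr, hΦ.coeff_zero_szegoReverse]
  obtain ⟨s, hs⟩ := X_dvd_iff.mpr h0
  -- The defect r = X s is orthogonal to X, ..., X^n, so s has degree below n and is orthogonal to
  -- all of 1, ..., X^(n-1).
  have hs0 : s = 0 := by
    refine hΦ.eq_zero_of_forall_X_pow (n := n) ?_ fun j hj => ?_
    · rw [degree_lt_iff_coeff_zero] at hdeg ⊢
      intro m hm
      rw [← coeff_X_mul, ← hs]
      exact hdeg _ (by omega)
    · rw [← circleForm_X_mul, ← hs, hr, circleForm_sub_left, circleForm_sub_left,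
        circleForm_C_mul_left, circleForm_X_mul, ← pow_succ', hΦ.circleForm_X_pow hj,
        hΦ.circleForm_szegoReverse_X_pow hj, hΦ.circleForm_X_pow (by omega)]
      simp
  rw [hs0, mul_zero] at hs
  rw [← sub_eq_zero, ← sub_sub, ← hr, hs]

lemma szego_recurrence_reverse (hΦ : IsMonicOPUC μ Φ) (n : ℕ) :
    szegoReverse (n + 1) (Φ (n + 1)) =
      szegoReverse n (Φ n) + C (conj ((Φ (n + 1)).coeff 0)) * (X * Φ n) := by
  have hn := (hΦ.natDegree_eq n).le
  conv_lhs => rw [hΦ.szego_recurrence n]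
  rw [szegoReverse_add, szegoReverse_C_mul, szegoReverse_succ_X_mul hn,
    szegoReverse_succ (natDegree_szegoReverse_le hn), szegoReverse_szegoReverse]

/-- Pythagoras in the Szegő recurrence gives ‖Φ_{n+1}‖² = (1 - |d_{n+1}|²) ‖Φ_n‖², because Φ_{n+1}
is orthogonal to Φ*_n. -/
lemma one_sub_coeff_zero_mul_conj_ne_zero (hΦ : IsMonicOPUC μ Φ) (n : ℕ) :
    1 - (Φ (n + 1)).coeff 0 * conj ((Φ (n + 1)).coeff 0) ≠ 0 := by
  intro h
  have hn := (hΦ.natDegree_eq n).le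
  set d := (Φ (n + 1)).coeff 0 with hd
  set R := szegoReverse n (Φ n) with hR
  have h1 : X * Φ n = Φ (n + 1) - C d * R := by
    conv_rhs => rw [hΦ.szego_recurrence n]
    rw [← hd, ← hR, add_sub_cancel_right]
  have hRR : circleForm μ R R = circleForm μ (Φ n) (Φ n) := circleForm_szegoReverse hn hn
  have h2 : circleForm μ (Φ (n + 1)) R = 0 :=
    hΦ.circleForm_eq_zero_of_degree_lt
      (degree_le_natDegree.trans_lt
        (by exact_mod_cast Nat.lt_succ_of_le (natDegree_szegoReverse_le hn)))
  have h3 : circleForm μ R (Φ (n + 1)) = 0 := by rw [← circleForm_conj, h2, map_zero]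
  have h4 := circleForm_X_mul (μ := μ) (Φ n) (Φ n)
  rw [h1, circleForm_sub_left, circleForm_sub_right, circleForm_sub_right,
    circleForm_C_mul_left, circleForm_C_mul_left, circleForm_C_mul_right,
    circleForm_C_mul_right, h2, h3, hRR] at h4
  refine hΦ.circleForm_self_ne_zero (n + 1) ?_
  linear_combination h4 + circleForm μ (Φ n) (Φ n) * h

/-- Monic orthogonal polynomials have no zeros on the unit circle. -/
lemma eval_ne_zero (hΦ : IsMonicOPUC μ Φ) (n : ℕ) (ζ : Circle) : (Φ n).eval (ζ : ℂ) ≠ 0 := by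
  intro h
  obtain ⟨q, hq⟩ := dvd_iff_isRoot.mpr h
  have hq0 : q ≠ 0 := by
    rintro rfl
    exact (hΦ.monic n).ne_zero (by rw [hq, mul_zero])
  have hdeg : q.degree < n := by
    have h1 := congrArg natDegree hq
    rw [natDegree_mul (X_sub_C_ne_zero _) hq0, natDegree_X_sub_C, hΦ.natDegree_eq] at h1
    rw [degree_eq_natDegree hq0]
    exact_mod_cast (by omega)
  -- Orthogonality to q gives ⟨Xq, q⟩ = ζ⟨q, q⟩; expanding ‖(X - ζ)q‖² with |ζ| = 1 then yields 0.
  have hq' : Φ n = X * q - C (ζ : ℂ) * q := by rw [hq, sub_mul]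
  have h1 : circleForm μ (Φ n) q = 0 := hΦ.circleForm_eq_zero_of_degree_lt hdeg
  have h2 : circleForm μ (X * q) q = ζ * circleForm μ q q := by
    rwa [hq', circleForm_sub_left, circleForm_C_mul_left, sub_eq_zero] at h1
  have h3 : circleForm μ q (X * q) = conj (ζ : ℂ) * circleForm μ q q := by
    rw [← circleForm_conj, h2, map_mul, circleForm_conj]
  refine hΦ.circleForm_self_ne_zero n ?_
  rw [hq', circleForm_sub_left, circleForm_sub_right, circleForm_sub_right,
    circleForm_C_mul_left, circleForm_C_mul_left, circleForm_C_mul_right,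
    circleForm_C_mul_right, circleForm_X_mul, h2, h3]
  linear_combination (-circleForm μ q q) * Circle.mul_conj_coe ζ

end IsMonicOPUC

/-! ### Comparison of the two recurrences -/

section Quasi

/-- The constant and top coefficients form a 2×2 system with determinant ±(1 - |d_{n+1}|²). Index 0
is excluded because Φ_0 = Φ*_0 = 1. -/
lemma IsMonicOPUC.eq_zero_of_C_mul_add_C_mul_szegoReverse {μ : Measure Circle}
    [IsFiniteMeasure μ] {Φ : ℕ → ℂ[X]} (hΦ : IsMonicOPUC μ Φ) {n : ℕ} {b c : ℂ}
    (h : C b * Φ (n + 1) + C c * szegoReverse (n + 1) (Φ (n + 1)) = 0) : b = 0 ∧ c = 0 := by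
  have h0 := congrArg (fun p => p.coeff 0) h
  have h1 := congrArg (fun p => p.coeff (n + 1)) h
  simp only [coeff_add, coeff_C_mul, coeff_zero, hΦ.coeff_zero_szegoReverse,
    coeff_szegoReverse le_rfl, hΦ.coeff_self, Nat.sub_self, mul_one] at h0 h1
  have hc : c = 0 := by
    refine (mul_eq_zero.mp ?_).resolve_right (hΦ.one_sub_coeff_zero_mul_conj_ne_zero n)
    linear_combination h0 - (Φ (n + 1)).coeff 0 * h1
  subst hc
  exact ⟨by simpa using h1, rfl⟩

variable {μ μt : Measure Circle} [IsFiniteMeasure μ] [IsFiniteMeasure μt] {Φ : ℕ → ℂ[X]}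
  {a : ℕ → ℂ}

/-- After both recurrences are substituted, the identity Φ_{m+1} - d_{m+1} Φ*_{m+1} = (1 -
|d_{m+1}|²) X Φ_m makes every remaining term divisible by X. -/
lemma quasiOPUC_recurrence (hΦ : IsMonicOPUC μ Φ) (hΦt : IsMonicOPUC μt (quasiOPUC Φ a))
    (m : ℕ) :
    C (a (m + 1) - a (m + 2) *
        (1 - (Φ (m + 1)).coeff 0 * conj ((Φ (m + 1)).coeff 0))) * Φ m +
      C ((quasiOPUC Φ a (m + 2)).coeff 0 * conj (a (m + 1))) * szegoReverse m (Φ m) = 0 := by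
  have hm := (hΦ.natDegree_eq m).le
  have e1 := hΦ.szego_recurrence m
  have e2 := hΦ.szego_recurrence (m + 1)
  have e3 := hΦ.szego_recurrence_reverse m
  have e4 := hΦt.szego_recurrence (m + 1)
  have e5 : (quasiOPUC Φ a (m + 2)).coeff 0 =
      (Φ (m + 2)).coeff 0 - a (m + 2) * (Φ (m + 1)).coeff 0 := by
    simp [quasiOPUC]
  set dt := (quasiOPUC Φ a (m + 2)).coeff 0
  set d2 := (Φ (m + 2)).coeff 0
  set d1 := (Φ (m + 1)).coeff 0
  have e6 : szegoReverse (m + 1) (quasiOPUC Φ a (m + 1)) =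
      szegoReverse (m + 1) (Φ (m + 1)) - C (conj (a (m + 1))) * (X * szegoReverse m (Φ m)) := by
    rw [quasiOPUC, szegoReverse_sub, szegoReverse_C_mul, szegoReverse_succ hm]
  rw [e6] at e4
  simp only [quasiOPUC] at e4
  rw [e2, e3] at e4
  have e7 : C dt = C d2 - C (a (m + 2)) * C d1 := by rw [e5, C_sub, C_mul]
  refine (mul_eq_zero.mp (?_ : X * _ = 0)).resolve_left X_ne_zero
  simp only [C_sub, C_mul, C_1]
  linear_combination e4 + C (a (m + 2)) * e1 +
    (szegoReverse m (Φ m) + C (conj d1) * (X * Φ m)) * e7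

lemma quasiOPUC_add_three (hΦ : IsMonicOPUC μ Φ) (ha : ∃ n, 1 ≤ n ∧ a n ≠ 0)
    (hΦt : IsMonicOPUC μt (quasiOPUC Φ a)) (m : ℕ) :
    quasiOPUC Φ a (m + 3) = X * quasiOPUC Φ a (m + 2) := by
  have key (k : ℕ) :
      a (k + 2) = a (k + 3) * (1 - (Φ (k + 2)).coeff 0 * conj ((Φ (k + 2)).coeff 0)) ∧
        (quasiOPUC Φ a (k + 3)).coeff 0 * conj (a (k + 2)) = 0 := by
    have h := hΦ.eq_zero_of_C_mul_add_C_mul_szegoReverse (quasiOPUC_recurrence hΦ hΦt (k + 1))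
    exact ⟨sub_eq_zero.mp h.1, h.2⟩
  have h2 : a 2 ≠ 0 := by
    intro h2
    have hz (k : ℕ) : a (k + 2) = 0 := by
      induction k with
      | zero => exact h2
      | succ k ih =>
        have h := (key k).1
        rw [ih, eq_comm, mul_eq_zero] at h
        exact h.resolve_right (hΦ.one_sub_coeff_zero_mul_conj_ne_zero (k + 1))
    have h1 : a 1 ≠ 0 := by
      obtain ⟨n, hn, hne⟩ := ha
      obtain rfl | ⟨k, rfl⟩ : n = 1 ∨ ∃ k, n = k + 2 :=
        hn.eq_or_lt.imp Eq.symm fun h => ⟨n - 2, by omega⟩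
      · exact hne
      · exact absurd (hz k) hne
    -- For m = 0 the relation reads a_1 + Φt_2(0) * conj a_1 = 0, which forces |Φt_2(0)| = 1,
    -- impossible for the family of `μt`.
    have h := congrArg (fun p => p.coeff 0) (quasiOPUC_recurrence hΦ hΦt 0)
    simp only [zero_add, h2, zero_mul, sub_zero, coeff_add, coeff_C_mul, coeff_zero,
      hΦ.coeff_zero_szegoReverse, hΦ.coeff_self, mul_one] at h
    have h' := congrArg conj h
    simp only [map_add, map_mul, map_zero, Complex.conj_conj] at h'
    refine mul_ne_zero h1 (hΦt.one_sub_coeff_zero_mul_conj_ne_zero 1) ?_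
    linear_combination h - (quasiOPUC Φ a 2).coeff 0 * h'
  have hz (k : ℕ) : a (k + 2) ≠ 0 := by
    induction k with
    | zero => exact h2
    | succ k ih => exact fun h => ih (by rw [(key k).1, h, zero_mul])
  have hd : (quasiOPUC Φ a (m + 3)).coeff 0 = 0 :=
    (mul_eq_zero.mp (key m).2).resolve_right ((_root_.map_ne_zero _).mpr (hz m))
  rw [hΦt.szego_recurrence (m + 2), hd, C_0, zero_mul, add_zero]

lemma quasiOPUC_add_two (hΦ : IsMonicOPUC μ Φ) (ha : ∃ n, 1 ≤ n ∧ a n ≠ 0)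
    (hΦt : IsMonicOPUC μt (quasiOPUC Φ a)) (m : ℕ) :
    quasiOPUC Φ a (m + 2) = X ^ m * quasiOPUC Φ a 2 := by
  induction m with
  | zero => simp
  | succ m ih => rw [quasiOPUC_add_three hΦ ha hΦt, ih, pow_succ']; ring

end Quasi

/-! ### Moments determine a measure on the circle -/

section FourierUniqueness

open BoundedContinuousFunction

/-- The inclusion of the unit circle in `ℂ`, as a bounded continuous function. -/
noncomputable def circleCoe : BoundedContinuousFunction Circle ℂ :=
  .mkOfCompact ⟨fun z => (z : ℂ), by fun_prop⟩

/-- Finite measures on the unit circle are determined by their moments. -/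
lemma Circle.measure_ext_of_forall_integral_pow_eq {μ ν : Measure Circle} [IsFiniteMeasure μ]
    [IsFiniteMeasure ν]
    (h : ∀ k : ℕ, ∫ z : Circle, (z : ℂ) ^ k ∂μ = ∫ z : Circle, (z : ℂ) ^ k ∂ν) : μ = ν := by
  have hconj (k : ℕ) :
      ∫ z : Circle, conj (z : ℂ) ^ k ∂μ = ∫ z : Circle, conj (z : ℂ) ^ k ∂ν := by
    have hc (ρ : Measure Circle) :
        ∫ z : Circle, conj (z : ℂ) ^ k ∂ρ = conj (∫ z : Circle, (z : ℂ) ^ k ∂ρ) := by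
      rw [← integral_conj]
      simp only [map_pow]
    rw [hc, hc, h]
  have hmon (m n : ℕ) : ∫ z : Circle, (z : ℂ) ^ m * conj (z : ℂ) ^ n ∂μ =
      ∫ z : Circle, (z : ℂ) ^ m * conj (z : ℂ) ^ n ∂ν := by
    have hz (z : Circle) (k : ℕ) : (z : ℂ) ^ k * conj (z : ℂ) ^ k = 1 := by
      rw [← mul_pow, Circle.mul_conj_coe, one_pow]
    rcases le_total m n with hmn | hmn
    · obtain ⟨k, rfl⟩ := Nat.exists_eq_add_of_le hmn
      have e (z : Circle) : (z : ℂ) ^ m * conj (z : ℂ) ^ (m + k) = conj (z : ℂ) ^ k := by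
        rw [pow_add, ← mul_assoc, hz, one_mul]
      simp_rw [e, hconj]
    · obtain ⟨k, rfl⟩ := Nat.exists_eq_add_of_le hmn
      have e (z : Circle) : (z : ℂ) ^ (n + k) * conj (z : ℂ) ^ n = (z : ℂ) ^ k := by
        rw [pow_add, mul_right_comm, hz, one_mul]
      simp_rw [e, h]
  -- The star algebra generated by the coordinate separates points and is spanned by the monomials
  -- z^m * conj z^n, which `hmon` handles.
  refine ext_of_forall_mem_subalgebra_integral_eq_of_pseudoEMetric_complete_countable
    (𝕜 := ℂ) (A := StarAlgebra.adjoin ℂ {circleCoe}) ?_ fun g hg => ?_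
  · intro x y hxy
    refine ⟨fun z => (z : ℂ), ⟨toContinuousMapStarₐ ℂ circleCoe, ⟨circleCoe,
      StarAlgebra.subset_adjoin ℂ _ rfl, rfl⟩, rfl⟩, fun h => hxy (Subtype.ext h)⟩
  · have hg' : g ∈ Submodule.span ℂ
        (Submonoid.closure ({circleCoe, star circleCoe} : Set (Circle →ᵇ ℂ)) :
          Set (Circle →ᵇ ℂ)) := by
      rw [← Algebra.adjoin_eq_span]
      rw [← StarSubalgebra.mem_toSubalgebra, StarAlgebra.adjoin_toSubalgebra,
        Set.star_singleton, Set.singleton_union] at hg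
      exact hg
    have hint (ρ : Measure Circle) [IsFiniteMeasure ρ] (f : Circle →ᵇ ℂ) : Integrable f ρ :=
      f.integrable ρ
    clear hg
    induction hg' using Submodule.span_induction with
    | mem x hx =>
      obtain ⟨m, n, rfl⟩ := (Submonoid.mem_closure_pair _ _ _).mp hx
      exact hmon m n
    | zero => simp
    | add x y _ _ hx hy =>
      simp only [BoundedContinuousFunction.coe_add, Pi.add_apply]
      rw [integral_add (hint _ _) (hint _ _), integral_add (hint _ _) (hint _ _)]
      rw [hx, hy]
    | smul c x _ hx =>
      simp only [BoundedContinuousFunction.coe_smul]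
      rw [integral_smul, integral_smul, hx]

end FourierUniqueness

/-! ### Arc length and densities -/

instance : IsFiniteMeasure circleLebesgue := by
  unfold circleLebesgue; infer_instance

lemma integral_circleLebesgue {f : Circle → ℂ} (hf : Continuous f) :
    ∫ z, f z ∂circleLebesgue = ∫ θ in (0 : ℝ)..(2 * Real.pi), f (Circle.exp θ) := by
  rw [circleLebesgue, integral_map (by fun_prop) hf.aestronglyMeasurable,
    intervalIntegral.integral_of_le Real.two_pi_pos.le, integral_Ioc_eq_integral_Ioo]

lemma integral_pow_circleLebesgue {k : ℕ} (hk : k ≠ 0) :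
    ∫ z : Circle, (z : ℂ) ^ k ∂circleLebesgue = 0 := by
  rw [integral_circleLebesgue (by fun_prop)]
  have hc : (k : ℂ) * Complex.I ≠ 0 :=
    mul_ne_zero (Nat.cast_ne_zero.mpr hk) Complex.I_ne_zero
  have h (θ : ℝ) : ((Circle.exp θ : Circle) : ℂ) ^ k = Complex.exp (k * Complex.I * θ) := by
    rw [Circle.coe_exp, ← Complex.exp_nat_mul]; ring_nf
  simp_rw [h]
  rw [integral_exp_mul_complex hc]
  have h1 : (k : ℂ) * Complex.I * ((2 * Real.pi : ℝ) : ℂ) = k * (2 * Real.pi * Complex.I) := by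
    push_cast; ring
  rw [h1, Complex.exp_nat_mul_two_pi_mul_I]
  simp

/-- A finite measure on the circle whose nontrivial moments vanish is a multiple of arc length. -/
lemma eq_smul_circleLebesgue {ν : Measure Circle} [IsFiniteMeasure ν]
    (h : ∀ k : ℕ, k ≠ 0 → ∫ z : Circle, (z : ℂ) ^ k ∂ν = 0) :
    ∃ c : NNReal, ν = c • circleLebesgue := by
  have hpos : circleLebesgue.real Set.univ ≠ 0 := by
    rw [circleLebesgue, measureReal_def, Measure.map_apply (by fun_prop) .univ]
    simp [ENNReal.toReal_ofReal Real.pi_pos.le, Real.pi_ne_zero]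
  obtain ⟨c, hc⟩ : ∃ c : NNReal, (c : ℝ) = ν.real Set.univ / circleLebesgue.real Set.univ :=
    ⟨⟨_, by positivity⟩, rfl⟩
  refine ⟨c, Circle.measure_ext_of_forall_integral_pow_eq fun k => ?_⟩
  rw [integral_smul_nnreal_measure]
  rcases eq_or_ne k 0 with rfl | hk
  · simp only [pow_zero, integral_const, NNReal.smul_def, smul_smul]
    rw [hc, div_mul_cancel₀ _ hpos]
  · rw [h k hk, integral_pow_circleLebesgue hk, smul_zero]

/-- Dividing by w gives the density c / w, which is continuous on a compact space and hence bounded.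
-/
lemma absolutelyContinuous_and_memLp_of_withDensity {μ : Measure Circle} {w : Circle → ℝ}
    (hw : Continuous w) (hpos : ∀ z, 0 < w z) {c : NNReal}
    (h : μ.withDensity (fun z => ENNReal.ofReal (w z)) = c • circleLebesgue) :
    μ ≪ circleLebesgue ∧
      MemLp (circleDensity μ) 2 (volume.restrict (Set.Ioo (0 : ℝ) (2 * Real.pi))) := by
  have hm : Measurable fun z => ENNReal.ofReal (w z) := hw.measurable.ennreal_ofReal
  have hμ : μ = circleLebesgue.withDensity (fun z => c * (ENNReal.ofReal (w z))⁻¹) := by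
    rw [← withDensity_inv_same (μ := μ) hm
      (.of_forall fun z => (ENNReal.ofReal_pos.mpr (hpos z)).ne')
      (.of_forall fun z => ENNReal.ofReal_ne_top), h]
    exact (withDensity_smul_measure (c : ENNReal) _).trans (withDensity_smul _ hm.inv).symm
  refine ⟨hμ ▸ withDensity_absolutelyContinuous _ _, ?_⟩
  have hd : μ.rnDeriv circleLebesgue =ᵐ[circleLebesgue]
      fun z => c * (ENNReal.ofReal (w z))⁻¹ := by
    conv_lhs => rw [hμ]
    exact Measure.rnDeriv_withDensity _ (hm.inv.const_mul _)
  have hd' := ae_of_ae_map (by fun_prop) hd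
  have hcont : Continuous fun z => (c : ℝ) * (w z)⁻¹ :=
    continuous_const.mul (hw.inv₀ fun z => (hpos z).ne')
  obtain ⟨K, hK⟩ := isCompact_univ.exists_bound_of_continuousOn hcont.continuousOn
  refine MemLp.ae_eq (f := fun θ : ℝ => (c : ℝ) * (w (Circle.exp θ))⁻¹) ?_
    (MemLp.of_bound (hcont.comp Circle.exp.continuous).aestronglyMeasurable K
      (.of_forall fun θ => hK _ trivial))
  filter_upwards [hd'] with θ hθ
  rw [circleDensity, hθ, ENNReal.toReal_mul, ENNReal.toReal_inv,
    ENNReal.toReal_ofReal (hpos _).le, ENNReal.coe_toReal]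

theorem mainTheorem4
    (μ μt : Measure Circle) [IsFiniteMeasure μ] [IsFiniteMeasure μt]
    (hμ : μ.support.Infinite)
    (Φ : ℕ → ℂ[X]) (hΦ : IsMonicOPUC μ Φ)
    (a : ℕ → ℂ) (ha : ∃ n, 1 ≤ n ∧ a n ≠ 0)
    (hΦt : IsMonicOPUC μt (quasiOPUC Φ a)) :
    μt ≪ circleLebesgue ∧
      MemLp (circleDensity μt) 2 (volume.restrict (Set.Ioo (0 : ℝ) (2 * Real.pi))) := by
  set P := quasiOPUC Φ a 2 with hP
  have hw : Continuous fun z : Circle => ‖P.eval (z : ℂ)‖ ^ 2 :=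
    (continuous_eval_circle P).norm.pow 2
  have hfin : IsFiniteMeasure
      (μt.withDensity fun z => ENNReal.ofReal (‖P.eval (z : ℂ)‖ ^ 2)) := by
    refine isFiniteMeasure_withDensity_ofReal (Integrable.hasFiniteIntegral ?_)
    rw [← integrableOn_univ]
    exact hw.continuousOn.integrableOn_compact isCompact_univ
  obtain ⟨c, hc⟩ := eq_smul_circleLebesgue (ν := μt.withDensity
      fun z => ENNReal.ofReal (‖P.eval (z : ℂ)‖ ^ 2)) fun k hk => by
    rw [integral_withDensity_eq_integral_toReal_smul hw.measurable.ennreal_ofReal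
      (.of_forall fun z => ENNReal.ofReal_lt_top)]
    -- Since Φt_{k+2} = z^k P, this integral is the k-th moment of |P|² dμt.
    have h := hΦt.orthogonal (k + 2) 2 (by omega)
    rw [quasiOPUC_add_two hΦ ha hΦt, ← hP] at h
    rw [← h]
    refine integral_congr_ae (.of_forall fun z => ?_)
    simp only [eval_mul, eval_pow, eval_X]
    rw [ENNReal.toReal_ofReal (by positivity), Complex.real_smul, mul_assoc, Complex.mul_conj,
      Complex.normSq_eq_norm_sq, mul_comm]
  exact absolutelyContinuous_and_memLp_of_withDensity hw
    (fun z => pow_pos (norm_pos_iff.mpr (hΦt.eval_ne_zero 2 z)) 2) hc
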